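/- Let $h:\{S,L\}^*\to\{0,1\}^*$ be the transduction sending a word $u=u_0u_1\cdots u_k$ (each $u_i\in\{S,L\}$) to the concatenation $h_0(u_0)h_1(u_1)\cdots h_k(u_k)$ (and the empty word to the empty word), where $h_i(S)=00100$ and $h_i(L)=00100100$ if $i$ is even, and $h_i(S)=11011$ and $h_i(L)=11011011$ if $i$ is odd. A word avoids $xxx^R$ if it has no factor (contiguous subword) of the form $xxx^R$ with $x$ a non-empty word and $x^R$ its reversal. Let $\mathcal{M}=\{u\in\{S,L\}^* : h(u)\text{ avoids }xxx^R\}$. Then there is a constant $c$ such that the number of words of length $n$ in $\mathcal{M}$ is $O(n^{\lg n+c})$ as $n\to\infty$, where $\lg$ denotes the base-$2$ logarithm. -/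

import Mathlib

open scoped Asymptotics

/-- The two-letter alphabet `{S, L}`. -/
inductive Block
  | S
  | L
  deriving DecidableEq

instance : Fintype Block where
  elems := {Block.S, Block.L}
  complete := by intro x; cases x <;> simp

/-- The word `w` avoids the pattern `x x xᴿ`: no factor (contiguous subword) of `w` is of the form
`x x xᴿ` with `x` non-empty, where `xᴿ` is the reversal of `x`. -/
def AvoidsXXXR {α : Type*} (w : List α) : Prop :=
  ∀ x : List α, x ≠ [] → ¬ (x ++ x ++ x.reverse) <:+: w

/-- The binary word written by the transducer `h` for a letter in position `i` (counted from 0). -/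
def hBlock (i : ℕ) : Block → List (Fin 2)
  | Block.S => if Even i then [0, 0, 1, 0, 0] else [1, 1, 0, 1, 1]
  | Block.L => if Even i then [0, 0, 1, 0, 0, 1, 0, 0] else [1, 1, 0, 1, 1, 0, 1, 1]

/-- The transduction `h : {S, L}* → {0, 1}*`, sending `u = u₀ u₁ ⋯ uₙ` to the concatenation of the
words `hBlock i uᵢ`. -/
def hTrans (u : List Block) : List (Fin 2) :=
  (u.mapIdx hBlock).flatten

/-- The language `𝓜` of the words `u` over `{S, L}` such that `hTrans u` avoids `x x xᴿ`. -/
def languageM : Set (List Block) :=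
  {u | AvoidsXXXR (hTrans u)}

/-- There are only finitely many words of length `n` in `𝓜`, so that `Set.ncard` really counts
them. -/
theorem finite_languageM_length (n : ℕ) : {u ∈ languageM | u.length = n}.Finite :=
  (List.finite_length_eq Block n).subset fun _ hu => hu.2

/-! Forbid only two families of words, each of which forces some $xxx^R$ in the image under $h$; the
words free of them are `Good`, and they contain $\mathcal M$. Small forbidden words make a good
word, away from its ends, free of $LLL$, $SSL$ and $LSLSLS$. Such a word is, up to bounded pieces
and one final power of $S$, an image under $S\mapsto LSL$, $L\mapsto LSLSL$
(`Good.exists_decomposition`). The morphism carries forbidden words to words with a forbidden factor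
(`Forbidden.morph`), so the preimage is good again and at most a third as long. Hence the number
$G(n)$ of good words of length at most $n$ satisfies $G(n)\le D(n+1)G(n/2)$; iterating about $\lg n$
times gives the bound. -/

namespace XXXR

open Block

/-! ### The transducer and reversal -/

/-- The binary block written for a letter, depending on whether its position is odd. -/
def block (e : Bool) : Block → List (Fin 2)
  | S => if e then [1, 1, 0, 1, 1] else [0, 0, 1, 0, 0]
  | L => if e then [1, 1, 0, 1, 1, 0, 1, 1] else [0, 0, 1, 0, 0, 1, 0, 0]

/-- The transduction started at an even (`e = false`) or odd (`e = true`) position. -/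
def trans : Bool → List Block → List (Fin 2)
  | _, [] => []
  | e, a :: u => block e a ++ trans (!e) u

lemma hBlock_eq_block (i : ℕ) (a : Block) : hBlock i a = block (decide (Odd i)) a := by
  by_cases h : Even i <;> cases a <;> simp [hBlock, block, h, ← Nat.not_even_iff_odd]

lemma flatten_mapIdx_hBlock (u : List Block) (k : ℕ) :
    (u.mapIdx fun i => hBlock (i + k)).flatten = trans (decide (Odd k)) u := by
  induction u generalizing k with
  | nil => simp [trans]
  | cons a u ih =>
    have h : (!decide (Odd k)) = decide (Odd (k + 1)) := by
      by_cases hk : Odd k <;> simp [hk, Nat.odd_add_one]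
    rw [List.mapIdx_cons, List.flatten_cons, trans, h, ← ih (k + 1), ← hBlock_eq_block]
    simp [Nat.add_assoc, Nat.add_comm 1 k]

lemma hTrans_eq_trans (u : List Block) : hTrans u = trans false u := by
  simpa [hTrans] using flatten_mapIdx_hBlock u 0

lemma trans_append (e : Bool) (u v : List Block) :
    trans e (u ++ v) = trans e u ++ trans (e ^^ decide (Odd u.length)) v := by
  induction u generalizing e with
  | nil => simp [trans]
  | cons a u ih =>
    have h : ((!e) ^^ decide (Odd u.length)) = (e ^^ decide (Odd (u.length + 1))) := by
      by_cases hk : Odd u.length <;> cases e <;> simp [hk, Nat.odd_add_one]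
    simp [trans, ih, h]

lemma trans_append_of_odd (e : Bool) {u : List Block} (hu : Odd u.length) (v : List Block) :
    trans e (u ++ v) = trans e u ++ trans (!e) v := by
  simp [trans_append, hu]

lemma trans_append_of_even (e : Bool) {u : List Block} (hu : Even u.length) (v : List Block) :
    trans e (u ++ v) = trans e u ++ trans e v := by
  simp [trans_append, Nat.not_odd_iff_even.2 hu]

lemma reverse_block (e : Bool) (a : Block) : (block e a).reverse = block e a := by
  cases e <;> cases a <;> simp [block]

lemma reverse_trans (e : Bool) (u : List Block) :
    (trans e u).reverse = trans (!(e ^^ decide (Odd u.length))) u.reverse := by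
  induction u generalizing e with
  | nil => simp [trans]
  | cons a u ih =>
    simp only [trans, List.reverse_append, ih, reverse_block, List.reverse_cons, trans_append,
      List.length_reverse, List.append_nil, List.length_cons]
    by_cases hk : Odd u.length <;> cases e <;> simp [hk, Nat.odd_add_one]

lemma reverse_trans_of_odd (e : Bool) {u : List Block} (hu : Odd u.length) :
    (trans e u).reverse = trans e u.reverse := by
  simp [reverse_trans, hu]

lemma reverse_trans_of_even (e : Bool) {u : List Block} (hu : Even u.length) :
    (trans e u).reverse = trans (!e) u.reverse := by
  simp [reverse_trans, Nat.not_odd_iff_even.2 hu]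

/-! ### Forbidden words -/

/-- Words over `{S, L}` whose image under the transduction contains a factor `x x xᴿ`. -/
inductive Forbidden : List Block → Prop
  | odd (a b c : Block) (w : List Block) (hw : Odd w.length) :
      Forbidden (a :: (w ++ b :: (w ++ L :: (w.reverse ++ [c]))))
  | even (p q y : List Block) (hy : Even y.length) (hp : p = [L] ∨ ∃ a, p = [a, S])
      (hq : q = [L] ∨ ∃ c, q = [S, c]) :
      Forbidden (p ++ (y ++ S :: S :: (y ++ L :: (y.reverse ++ q))))

/-- The words without forbidden factors. -/
def Good (u : List Block) : Prop :=
  ∀ z, z <:+: u → ¬ Forbidden z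

lemma Good.of_infix {u v : List Block} (hv : Good v) (h : u <:+: v) : Good u :=
  fun z hz => hv z (hz.trans h)

lemma trans_infix (e : Bool) {z u : List Block} (h : z <:+: u) :
    ∃ e', trans e' z <:+: trans e u := by
  obtain ⟨s, t, rfl⟩ := h
  rw [List.append_assoc, trans_append, trans_append]
  exact ⟨_, _, _, List.append_assoc _ _ _⟩

/-- Both parities `e` are needed because a factor may start at an even or an odd position. -/
lemma Forbidden.exists_infix_trans {z : List Block} (h : Forbidden z) (e : Bool) :
    ∃ x : List (Fin 2), x ≠ [] ∧ (x ++ x ++ x.reverse) <:+: trans e z := by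
  cases h with
  | odd a b c w hw =>
    have hw' : Odd w.reverse.length := by simpa using hw
    simp only [trans, trans_append_of_odd _ hw, trans_append_of_odd _ hw', Bool.not_not]
    rw [← reverse_trans_of_odd _ hw]
    generalize trans (!e) w = W
    cases e
    -- The block of `L` is cut as `0010|0100`, a palindrome about the cut, and $x^R$ starts there.
    -- The block of `b` is cut after `0010`, where the first $x$ ends. The blocks of `a` and `c`
    -- supply the outer ends whatever these letters are.
    · refine ⟨(block false b).drop 4 ++ W ++ [0, 0, 1, 0], by simp,
        (block false a).take (if b = S then (if a = S then 4 else 7) else if a = S then 1 else 4),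
        (block false c).drop (if b = S then 1 else 4), ?_⟩
      cases a <;> cases b <;> cases c <;> simp [block]
    · refine ⟨(block true b).drop 4 ++ W ++ [1, 1, 0, 1], by simp,
        (block true a).take (if b = S then (if a = S then 4 else 7) else if a = S then 1 else 4),
        (block true c).drop (if b = S then 1 else 4), ?_⟩
      cases a <;> cases b <;> cases c <;> simp [block]
  | even p q y hy hp hq =>
    have hy' : Even y.reverse.length := by simpa using hy
    have key : ∀ e, ∃ x : List (Fin 2), x ≠ [] ∧ (x ++ x ++ x.reverse) <:+:
        (block e S).drop 4 ++ block (!e) S ++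
          trans e (y ++ S :: S :: (y ++ L :: y.reverse)) ++ block (!e) S ++ (block e S).take 1 := by
      intro e
      simp only [trans, trans_append_of_even _ hy, Bool.not_not]
      rw [← reverse_trans_of_even _ hy]
      generalize trans e y = Y
      cases e
      · exact ⟨[0, 1, 1, 0, 1, 1] ++ Y ++ [0, 0, 1, 0], by simp, [], [], by simp [block]⟩
      · exact ⟨[1, 0, 0, 1, 0, 0] ++ Y ++ [1, 1, 0, 1], by simp, [], [], by simp [block]⟩
    -- For `p = [L]`, the block `11011011` ends in `0·11011`, just as the blocks of `[a, S]` do; `q`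
    -- is the mirror case.
    have hp' : ∀ e, ∃ e' l, ∀ v, trans e (p ++ v) =
        l ++ ((block e' S).drop 4 ++ block (!e') S ++ trans e' v) := by
      intro e
      rcases hp with rfl | ⟨a, rfl⟩
      · refine ⟨!e, (block e S).take 2, fun v => ?_⟩
        cases e <;> simp [trans, block]
      · refine ⟨e, (block e a).dropLast, fun v => ?_⟩
        cases e <;> cases a <;> simp [trans, block]
    have hq' : ∀ e, ∃ l, trans (!e) q = block (!e) S ++ (block e S).take 1 ++ l := by
      intro e
      rcases hq with rfl | ⟨a, rfl⟩
      · refine ⟨(block (!e) S).drop 3, ?_⟩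
        cases e <;> simp [trans, block]
      · refine ⟨(block e a).drop 1, ?_⟩
        cases e <;> cases a <;> simp [trans, block]
    obtain ⟨e', l, hl⟩ := hp' e
    obtain ⟨r, hr⟩ := hq' e'
    obtain ⟨x, hx, hx'⟩ := key e'
    refine ⟨x, hx, hx'.trans ⟨l, r, ?_⟩⟩
    rw [hl]
    simp only [trans, trans_append_of_even _ hy, trans_append_of_even _ hy', Bool.not_not, hr,
      List.append_assoc]

lemma good_of_mem_languageM {u : List Block} (hu : u ∈ languageM) : Good u := by
  intro z hz hf
  obtain ⟨e, he⟩ := trans_infix false hz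
  obtain ⟨x, hx, hx'⟩ := hf.exists_infix_trans e
  refine hu x hx ?_
  rw [hTrans_eq_trans]
  exact hx'.trans he

/-! ### The morphism and its desubstitution -/

/-- The morphism `S ↦ LSL`, `L ↦ LSLSL`. -/
def morph : List Block → List Block
  | [] => []
  | S :: u => L :: S :: L :: morph u
  | L :: u => L :: S :: L :: S :: L :: morph u

lemma morph_append (u v : List Block) : morph (u ++ v) = morph u ++ morph v := by
  induction u with
  | nil => rfl
  | cons a u ih => cases a <;> simp [morph, ih]

lemma reverse_morph (u : List Block) : (morph u).reverse = morph u.reverse := by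
  induction u with
  | nil => rfl
  | cons a u ih => cases a <;> simp [morph, ih, morph_append]

lemma odd_length_morph (u : List Block) : Odd (morph u).length ↔ Odd u.length := by
  induction u with
  | nil => rfl
  | cons a u ih => cases a <;> simp [morph, ih, parity_simps]

lemma length_morph_ge (u : List Block) : 3 * u.length ≤ (morph u).length := by
  induction u with
  | nil => simp
  | cons a u ih => cases a <;> simp [morph] <;> omega

lemma morph_infix {u v : List Block} (h : u <:+: v) : morph u <:+: morph v := by
  obtain ⟨s, t, rfl⟩ := h
  exact ⟨morph s, morph t, by simp [morph_append]⟩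

/-- Images of letters are palindromes, and that of `L` has an `L` at its centre, which serves as the
new centre. Both families land in `odd`: in the `even` case the new `w` gains five letters. -/
lemma Forbidden.morph {z : List Block} (h : Forbidden z) :
    ∃ z', Forbidden z' ∧ z' <:+: morph z := by
  cases h with
  | odd a b c w hw =>
    have hw' := (odd_length_morph w).2 hw
    cases b
    · refine ⟨_, .odd L L L (XXXR.morph w ++ [L, S]) (by simpa [parity_simps] using hw'),
        (XXXR.morph [a]).dropLast, (XXXR.morph [c]).drop 1, ?_⟩
      cases a <;> cases c <;> simp [XXXR.morph, morph_append, reverse_morph]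
    · refine ⟨_, .odd L L L ([S, L] ++ XXXR.morph w ++ [L, S]) (by simpa [parity_simps] using hw'),
        (XXXR.morph [a]).dropLast.dropLast.dropLast, (XXXR.morph [c]).drop 3, ?_⟩
      cases a <;> cases c <;> simp [XXXR.morph, morph_append, reverse_morph]
  | even p q y hy hp hq =>
    have hy' : Even (XXXR.morph y).length := by
      rw [← Nat.not_odd_iff_even, odd_length_morph]; simpa using hy
    have hp' : ∃ a l, XXXR.morph p = l ++ [a, L, S, L] := by
      rcases hp with rfl | ⟨a, rfl⟩
      · exact ⟨S, [L], by simp [XXXR.morph]⟩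
      · exact ⟨L, (XXXR.morph [a]).dropLast, by cases a <;> simp [XXXR.morph]⟩
    have hq' : ∃ c l, XXXR.morph q = [L, S, L, c] ++ l := by
      rcases hq with rfl | ⟨c, rfl⟩
      · exact ⟨S, [L], by simp [XXXR.morph]⟩
      · exact ⟨L, (XXXR.morph [c]).drop 1, by cases c <;> simp [XXXR.morph]⟩
    obtain ⟨a, l, hl⟩ := hp'
    obtain ⟨c, r, hr⟩ := hq'
    refine ⟨_, .odd a L c ([L, S, L] ++ XXXR.morph y ++ [L, S])
      (by simpa [parity_simps] using hy'), l, r, ?_⟩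
    simp [morph_append, reverse_morph, XXXR.morph, hl, hr]

lemma good_of_good_morph {v : List Block} (h : Good (morph v)) : Good v := by
  intro z hz hf
  obtain ⟨z', hz', hi⟩ := hf.morph
  exact h z' (hi.trans (morph_infix hz)) hz'

/-! ### Factoring smooth words -/

/-- Words avoiding the three factors that never occur far inside a good word. -/
structure Smooth (t : List Block) : Prop where
  lll : ¬ [L, L, L] <:+: t
  ssl : ¬ [S, S, L] <:+: t
  lslsls : ¬ [L, S, L, S, L, S] <:+: t

lemma Smooth.of_infix {t u : List Block} (hu : Smooth u) (h : t <:+: u) : Smooth t :=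
  ⟨fun k => hu.lll (k.trans h), fun k => hu.ssl (k.trans h), fun k => hu.lslsls (k.trans h)⟩

lemma Smooth.tail {a : Block} {t : List Block} (h : Smooth (a :: t)) : Smooth t :=
  h.of_infix ⟨[a], [], by simp⟩

lemma Smooth.eq_replicate {t : List Block} (h : Smooth (S :: S :: t)) :
    t = List.replicate t.length S := by
  induction t with
  | nil => rfl
  | cons a t ih =>
    cases a
    · rw [List.length_cons, List.replicate_succ, ← ih h.tail]
    · exact (h.ssl ⟨[], t, rfl⟩).elim

/-- A block boundary of `morph` is recognised by the factor `LL`. -/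
lemma Smooth.exists_morph {t : List Block} (h : Smooth (L :: L :: t)) :
    ∃ v r k, r.length ≤ 5 ∧ L :: t = morph v ++ r ++ List.replicate k S := by
  match t, h with
  | [], _ => exact ⟨[], [L], 0, by simp, rfl⟩
  | L :: t, h => exact (h.lll ⟨[], t, rfl⟩).elim
  | [S], _ => exact ⟨[], [L, S], 0, by simp, rfl⟩
  | S :: S :: t, h =>
    exact ⟨[], [L, S, S], t.length, by simp, by simp [morph, ← h.tail.tail.eq_replicate]⟩
  | [S, L], _ => exact ⟨[], [L, S, L], 0, by simp, rfl⟩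
  | S :: L :: L :: t, h =>
    obtain ⟨v, r, k, hr, e⟩ := Smooth.exists_morph h.tail.tail.tail
    exact ⟨S :: v, r, k, hr, by simp [morph, e]⟩
  | [S, L, S], _ => exact ⟨[], [L, S, L, S], 0, by simp, rfl⟩
  | S :: L :: S :: S :: t, h =>
    exact ⟨[], [L, S, L, S, S], t.length, by simp,
      by simp [morph, ← h.tail.tail.tail.tail.eq_replicate]⟩
  | [S, L, S, L], _ => exact ⟨[], [L, S, L, S, L], 0, by simp, rfl⟩
  | S :: L :: S :: L :: L :: t, h =>
    obtain ⟨v, r, k, hr, e⟩ := Smooth.exists_morph h.tail.tail.tail.tail.tail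
    exact ⟨L :: v, r, k, hr, by simp [morph, e]⟩
  | S :: L :: S :: L :: S :: t, h => exact (h.tail.lslsls ⟨[], t, rfl⟩).elim
termination_by t.length

/-- After an `L`, avoiding `LSLSLS` soon forces `LL` (a block boundary), `SS` (only `S` from there
on) or the end of the word. -/
lemma Smooth.exists_prefix_morph_of_cons {t : List Block} (h : Smooth (L :: t)) :
    ∃ p v r k, p.length ≤ 5 ∧ r.length ≤ 5 ∧ t = p ++ morph v ++ r ++ List.replicate k S := by
  match t, h with
  | [], _ => exact ⟨[], [], [], 0, by simp, by simp, rfl⟩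
  | L :: t, h =>
    obtain ⟨v, r, k, hr, e⟩ := h.exists_morph
    exact ⟨[], v, r, k, by simp, hr, by simp [e]⟩
  | [S], _ => exact ⟨[S], [], [], 0, by simp, by simp, rfl⟩
  | S :: S :: t, h =>
    exact ⟨[S, S], [], [], t.length, by simp, by simp, by simp [morph, ← h.tail.eq_replicate]⟩
  | [S, L], _ => exact ⟨[S, L], [], [], 0, by simp, by simp, rfl⟩
  | S :: L :: L :: t, h =>
    obtain ⟨v, r, k, hr, e⟩ := h.tail.tail.exists_morph
    exact ⟨[S, L], v, r, k, by simp, hr, by simp [e]⟩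
  | [S, L, S], _ => exact ⟨[S, L, S], [], [], 0, by simp, by simp, rfl⟩
  | S :: L :: S :: S :: t, h =>
    exact ⟨[S, L, S, S], [], [], t.length, by simp, by simp,
      by simp [morph, ← h.tail.tail.tail.eq_replicate]⟩
  | [S, L, S, L], _ => exact ⟨[S, L, S, L], [], [], 0, by simp, by simp, rfl⟩
  | S :: L :: S :: L :: L :: t, h =>
    obtain ⟨v, r, k, hr, e⟩ := h.tail.tail.tail.tail.exists_morph
    exact ⟨[S, L, S, L], v, r, k, by simp, hr, by simp [e]⟩
  | S :: L :: S :: L :: S :: t, h => exact (h.lslsls ⟨[], t, rfl⟩).elim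

lemma Smooth.exists_prefix_morph {t : List Block} (h : Smooth t) :
    ∃ p v r k, p.length ≤ 7 ∧ r.length ≤ 5 ∧ t = p ++ morph v ++ r ++ List.replicate k S := by
  match t, h with
  | [], _ => exact ⟨[], [], [], 0, by simp, by simp, rfl⟩
  | L :: t, h =>
    obtain ⟨p, v, r, k, hp, hr, e⟩ := h.exists_prefix_morph_of_cons
    exact ⟨L :: p, v, r, k, by simp; omega, hr, by simp [e]⟩
  | [S], _ => exact ⟨[S], [], [], 0, by simp, by simp, rfl⟩
  | S :: S :: t, h =>
    exact ⟨[S, S], [], [], t.length, by simp, by simp, by simp [morph, ← h.eq_replicate]⟩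
  | S :: L :: t, h =>
    obtain ⟨p, v, r, k, hp, hr, e⟩ := h.tail.exists_prefix_morph_of_cons
    exact ⟨S :: L :: p, v, r, k, by simp; omega, hr, by simp [e]⟩

/-! ### Good words are smooth inside -/

lemma not_good_of_odd {w : List Block} (hw : Odd w.length) (a b c : Block) :
    ¬ Good (a :: (w ++ b :: (w ++ L :: (w.reverse ++ [c])))) :=
  fun h => h _ List.infix_rfl (.odd a b c w hw)

lemma not_good_of_even {p q : List Block} (hp : p = [L] ∨ ∃ a, p = [a, S])
    (hq : q = [L] ∨ ∃ c, q = [S, c]) : ¬ Good (p ++ S :: S :: L :: q) :=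
  fun h => h _ List.infix_rfl (by simpa using Forbidden.even p q [] (by simp) hp hq)

/-- This is the `even` family with empty `y`: any two letters on either side contain a suitable `p`
or `q`. -/
lemma not_good_ssl (a b c d : Block) : ¬ Good [a, b, S, S, L, c, d] := by
  intro h
  obtain ⟨q, hq, hqi⟩ : ∃ q : List Block, (q = [L] ∨ ∃ c, q = [S, c]) ∧ q <+: [c, d] := by
    cases c
    · exact ⟨[S, d], by simp, by simp⟩
    · exact ⟨[L], by simp, by simp⟩
  obtain ⟨t, ht⟩ := hqi
  cases b
  · exact not_good_of_even (p := [a, S]) (by simp) hq (h.of_infix ⟨[], t, by simp [ht]⟩)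
  · exact not_good_of_even (p := [L]) (by simp) hq (h.of_infix ⟨[a], t, by simp [ht]⟩)

lemma not_good_slll (a b c d : Block) : ¬ Good [a, b, c, S, L, L, L, d] := by
  intro h
  cases c
  · exact not_good_ssl a b L L (h.of_infix ⟨[], [d], rfl⟩)
  · exact not_good_of_odd (w := [L]) (by simp) b S d (h.of_infix ⟨[a], [], rfl⟩)

lemma not_good_lll (a b c d e x : Block) : ¬ Good [a, b, c, d, e, L, L, L, x] := by
  intro h
  cases e
  · exact not_good_slll b c d x (h.of_infix ⟨[a], [], rfl⟩)
  · cases d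
    · exact not_good_slll a b c L (h.of_infix ⟨[], [x], rfl⟩)
    · exact not_good_of_odd (w := [L]) (by simp) c L x (h.of_infix ⟨[a, b], [], rfl⟩)

lemma Good.exists_context {l t r : List Block} (h : Good (l ++ t ++ r)) (hl : 5 ≤ l.length)
    (hr : 2 ≤ r.length) : ∃ a b c d e x y, Good ([a, b, c, d, e] ++ t ++ [x, y]) := by
  have h5 : (l.drop (l.length - 5)).length = 5 := by rw [List.length_drop]; omega
  have h2 : (r.take 2).length = 2 := by rw [List.length_take]; omega
  have hi : Good (l.drop (l.length - 5) ++ t ++ r.take 2) := by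
    refine h.of_infix ⟨l.take (l.length - 5), r.drop 2, ?_⟩
    conv_rhs => rw [← List.take_append_drop (l.length - 5) l, ← List.take_append_drop 2 r]
    simp only [List.append_assoc]
  obtain ⟨x, y, hxy⟩ := List.length_eq_two.1 h2
  match l.drop (l.length - 5), h5, hi with
  | [a, b, c, d, e], _, hi => exact ⟨a, b, c, d, e, x, y, hxy ▸ hi⟩

/-- Excluding `LLL` uses five letters on the left, excluding `SSL` two on the right. -/
lemma Good.smooth_of_append {p t s : List Block} (h : Good (p ++ t ++ s)) (hp : 5 ≤ p.length)
    (hs : 2 ≤ s.length) : Smooth t := by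
  have key : ∀ x, x <:+: t → ∃ a b c d e y z, Good ([a, b, c, d, e] ++ x ++ [y, z]) := by
    rintro x ⟨l, r, rfl⟩
    exact Good.exists_context (l := p ++ l) (r := r ++ s) (by simpa using h)
      (by rw [List.length_append]; omega) (by rw [List.length_append]; omega)
  refine ⟨fun hx => ?_, fun hx => ?_, fun hx => ?_⟩ <;>
    obtain ⟨a, b, c, d, e, y, z, hg⟩ := key _ hx
  · exact not_good_lll a b c d e y (hg.of_infix ⟨[], [z], rfl⟩)
  · exact not_good_ssl d e y z (hg.of_infix ⟨[a, b, c], [], rfl⟩)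
  · exact not_good_of_odd (w := [S]) (by simp) L L y (hg.of_infix ⟨[a, b, c, d, e], [z], rfl⟩)

/-- Up to bounded pieces and one power of `S`, good words are images of good words. -/
lemma Good.exists_decomposition {u : List Block} (h : Good u) :
    ∃ p v r k s, p.length ≤ 12 ∧ r.length ≤ 12 ∧ s.length ≤ 12 ∧ Good v ∧
      3 * v.length ≤ u.length ∧ k ≤ u.length ∧
      u = p ++ morph v ++ r ++ List.replicate k S ++ s := by
  by_cases hu : u.length < 7
  · refine ⟨u, [], [], 0, [], by omega, by simp, by simp, ?_, by simp, by simp, by simp [morph]⟩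
    exact h.of_infix (List.nil_infix)
  obtain ⟨p₀, t, s, rfl, hp₀, hs⟩ : ∃ p₀ t s, u = p₀ ++ t ++ s ∧ p₀.length = 5 ∧ s.length = 2 := by
    refine ⟨u.take 5, (u.drop 5).take (u.length - 7), (u.drop 5).drop (u.length - 7), ?_, ?_, ?_⟩
    · rw [List.append_assoc, List.take_append_drop, List.take_append_drop]
    · rw [List.length_take]; omega
    · rw [List.length_drop, List.length_drop]; omega
  obtain ⟨p, v, r, k, hp, hr, rfl⟩ := (h.smooth_of_append hp₀.ge hs.ge).exists_prefix_morph
  have hv := length_morph_ge v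
  refine ⟨p₀ ++ p, v, r, k, s, by rw [List.length_append]; omega, by omega, by omega,
    good_of_good_morph (h.of_infix ⟨p₀ ++ p, r ++ List.replicate k S ++ s, by simp⟩), ?_, ?_,
    by simp⟩ <;> simp only [List.length_append, List.length_replicate] <;> omega

/-! ### Counting -/

/-- The good words of length at most `n`. -/
def goodWords (n : ℕ) : Set (List Block) :=
  {u | Good u ∧ u.length ≤ n}

lemma finite_goodWords (n : ℕ) : (goodWords n).Finite :=
  (List.finite_length_le Block n).subset fun _ hu => hu.2

lemma exists_ncard_goodWords_le :
    ∃ D : ℕ, ∀ n, (goodWords n).ncard ≤ D * (n + 1) * (goodWords (n / 2)).ncard := by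
  set P : Set (List Block) := {u | u.length ≤ 12}
  have hP : P.Finite := List.finite_length_le Block 12
  refine ⟨P.ncard * P.ncard * P.ncard, fun n => ?_⟩
  have hfin : ((P ×ˢ P ×ˢ P) ×ˢ Set.Iic n ×ˢ goodWords (n / 2)).Finite :=
    (hP.prod (hP.prod hP)).prod ((Set.finite_Iic n).prod (finite_goodWords _))
  calc (goodWords n).ncard
      ≤ ((fun x : (List Block × List Block × List Block) × ℕ × List Block =>
          x.1.1 ++ morph x.2.2 ++ x.1.2.1 ++ List.replicate x.2.1 S ++ x.1.2.2) ''
          ((P ×ˢ P ×ˢ P) ×ˢ Set.Iic n ×ˢ goodWords (n / 2))).ncard := by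
        refine Set.ncard_le_ncard ?_ (hfin.image _)
        rintro u ⟨hu, hun⟩
        obtain ⟨p, v, r, k, s, hp, hr, hs, hv, hvl, hk, e⟩ := hu.exists_decomposition
        -- Halving, weaker than the available third, already suffices.
        have hvn : v.length ≤ n / 2 := by omega
        exact ⟨((p, r, s), k, v), ⟨⟨hp, hr, hs⟩, hk.trans hun, hv, hvn⟩, e.symm⟩
    _ ≤ ((P ×ˢ P ×ˢ P) ×ˢ Set.Iic n ×ˢ goodWords (n / 2)).ncard := Set.ncard_image_le hfin
    _ = _ := by
        have : (Set.Iic n).ncard = n + 1 := by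
          rw [Set.ncard_eq_toFinset_card']; simp
        simp only [Set.ncard_prod, this]
        ring

/-- The factors $n+1\le 2^i$ for $i\le j$ multiply to $2^{j(j+1)/2}$; the constants contribute
$D^j\le 2^{Dj}$. -/
lemma exists_ncard_goodWords_le_two_pow :
    ∃ d C : ℕ, ∀ j n, n < 2 ^ j → (goodWords n).ncard ≤ C * 2 ^ (d * j + j * (j + 1) / 2) := by
  obtain ⟨D, hD⟩ := exists_ncard_goodWords_le
  refine ⟨D, (goodWords 0).ncard, fun j => ?_⟩
  induction j with
  | zero =>
    intro n hn
    obtain rfl : n = 0 := by simpa using hn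
    simp
  | succ j ih =>
    intro n hn
    rw [pow_succ] at hn
    have hj : (j + 1) * (j + 1 + 1) / 2 = j * (j + 1) / 2 + (j + 1) := by
      rw [show (j + 1) * (j + 1 + 1) = j * (j + 1) + (j + 1) * 2 by ring,
        Nat.add_mul_div_right _ _ two_pos]
    calc (goodWords n).ncard ≤ D * (n + 1) * (goodWords (n / 2)).ncard := hD n
      _ ≤ 2 ^ D * 2 ^ (j + 1) * ((goodWords 0).ncard * 2 ^ (D * j + j * (j + 1) / 2)) := by
        gcongr
        · exact Nat.lt_two_pow_self.le
        · rw [pow_succ]; omega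
        · exact ih _ (by omega)
      _ = _ := by rw [hj]; ring

end XXXR

theorem mainTheorem5 :
    ∃ c : ℝ,
      (fun n : ℕ => (({u ∈ languageM | u.length = n}.ncard : ℕ) : ℝ)) =O[Filter.atTop]
        (fun n : ℕ => (n : ℝ) ^ (Real.logb 2 (n : ℝ) + c)) := by
  obtain ⟨d, C, h⟩ := XXXR.exists_ncard_goodWords_le_two_pow
  -- With $j\le l+1$, the exponent is at most $d(l+1)+(l+1)(l+2)/2$: its linear coefficient is
  -- $d+3/2$, its constant term $d+1$, and $l^2/2$ is to spare.
  refine ⟨d + 3 / 2, .of_bound (C * 2 ^ (d + 1)) ?_⟩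
  filter_upwards [Filter.eventually_ge_atTop 1] with n hn
  have hn0 : (0 : ℝ) < n := by exact_mod_cast hn
  set l := Real.logb 2 n
  have hl : 0 ≤ l := Real.logb_nonneg one_lt_two (by exact_mod_cast hn)
  set j := Nat.log 2 n + 1
  have hjl : (j : ℝ) ≤ l + 1 := by
    simpa [j] using Real.natLog_le_logb n 2
  have hsub : {u ∈ languageM | u.length = n} ⊆ XXXR.goodWords n :=
    fun u hu => ⟨XXXR.good_of_mem_languageM hu.1, hu.2.le⟩
  have hcard : {u ∈ languageM | u.length = n}.ncard ≤ C * 2 ^ (d * j + j * (j + 1) / 2) :=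
    (Set.ncard_le_ncard hsub (XXXR.finite_goodWords n)).trans (h j n (Nat.lt_pow_succ_log_self one_lt_two n))
  have hexp : ((d * j + j * (j + 1) / 2 : ℕ) : ℝ) ≤ (d + 1) + l * (l + (d + 3 / 2)) := by
    have h1 : ((j * (j + 1) / 2 : ℕ) : ℝ) ≤ (j * (j + 1) : ℝ) / 2 := by
      simpa using Nat.cast_div_le (α := ℝ) (m := j * (j + 1)) (n := 2)
    have h2 : (j * (j + 1) : ℝ) ≤ (l + 1) * (l + 1 + 1) := by gcongr
    have h3 : (d * j : ℝ) ≤ d * (l + 1) := by gcongr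
    push_cast
    nlinarith [mul_nonneg hl hl]
  have hpow : (n : ℝ) ^ (l + (d + 3 / 2)) = 2 ^ (l * (l + (d + 3 / 2))) := by
    rw [Real.rpow_mul two_pos.le, Real.rpow_logb two_pos (by norm_num) hn0]
  rw [Real.norm_natCast, hpow, Real.norm_of_nonneg (by positivity)]
  calc (({u ∈ languageM | u.length = n}.ncard : ℕ) : ℝ)
      ≤ C * 2 ^ (d * j + j * (j + 1) / 2) := by exact_mod_cast hcard
    _ = C * (2 : ℝ) ^ ((d * j + j * (j + 1) / 2 : ℕ) : ℝ) := by rw [Real.rpow_natCast]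
    _ ≤ C * (2 : ℝ) ^ ((d + 1 : ℝ) + l * (l + (d + 3 / 2))) := by
        gcongr
        exact one_le_two
    _ = C * 2 ^ (d + 1) * 2 ^ (l * (l + (d + 3 / 2))) := by
        rw [Real.rpow_add two_pos, mul_assoc]
        norm_cast
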